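/- All topological groups are assumed to be Tychonoff (equivalently, Hausdorff). Let $\alpha$ be an infinite cardinal. A topological space $X$ is \emph{$\alpha$-pseudocompact} if $f(X)$ is compact for every continuous function $f:X\to\mathbb R^\alpha$. Let $G$ be an $\alpha$-pseudocompact topological abelian group. A subgroup $D$ of $G$ is called dense $\alpha$-pseudocompact if it is dense in $G$ and $\alpha$-pseudocompact in the subspace topology. The group $G$ is: \begin{itemize} \item \emph{$s_\alpha$-extremal} if it has no proper dense $\alpha$-pseudocompact subgroup; \item \emph{$r_\alpha$-extremal} if there is no strictly finer $\alpha$-pseudocompact group topology on $G$; \item \emph{$d_\alpha$-extremal} if $G/D$ is divisible for every dense $\alpha$-pseudocompact subgroup $D$ of $G$; \item \emph{$c_\alpha$-extremal} if $r_0(G/D)<2^\alpha$ for every dense $\alpha$-pseudocompact subgroup $D$ of $G$, where $r_0$ denotes the free rank, i.e. the maximal cardinality of a $\mathbb Z$-linearly independent subset; \item \emph{$\alpha$-extremal} if it is both $d_\alpha$- and $c_\alpha$-extremal. \end{itemize} \textbf{Theorem.} Let $\alpha$ be an infinite cardinal and let $G$ be an $\alpha$-pseudocompact abelian group which is $s_\alpha$-extremal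 or $r_\alpha$-extremal. Then $G$ is $\alpha$-extremal. -/

import Mathlib

universe u v

open Cardinal

/-- A topological space `X` is `α`-pseudocompact if the image of every continuous map
`X → ℝ^α` is compact, where `ℝ^α` is the product of `α` many copies of the real line. -/
def AlphaPseudocompact (α : Cardinal.{v}) (X : Type u) [TopologicalSpace X] : Prop :=
  ∀ f : X → (α.out → ℝ), Continuous f → IsCompact (Set.range f)

/-- `D` is a dense `α`-pseudocompact subgroup of the topological group `G`
(`D` carries the subspace topology). -/
def IsDenseAlphaPseudocompact (α : Cardinal.{v}) {G : Type u} [AddGroup G] [TopologicalSpace G]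
    (D : AddSubgroup G) : Prop :=
  Dense (D : Set G) ∧ AlphaPseudocompact α D

/-- `s_α`-extremality: no proper dense `α`-pseudocompact subgroup. -/
def SAlphaExtremal (α : Cardinal.{v}) (G : Type u) [AddGroup G] [TopologicalSpace G] : Prop :=
  ∀ D : AddSubgroup G, IsDenseAlphaPseudocompact α D → D = ⊤

/-- `r_α`-extremality: no strictly finer (Tychonoff) `α`-pseudocompact group topology.
In Mathlib's order on topologies, `τ' < τ` means that `τ'` is strictly finer than `τ`. -/
def RAlphaExtremal (α : Cardinal.{v}) (G : Type u) [AddGroup G] [τ : TopologicalSpace G] : Prop :=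
  ¬ ∃ τ' : TopologicalSpace G, τ' < τ ∧ @IsTopologicalAddGroup G τ' _ ∧ @T35Space G τ' ∧
    @AlphaPseudocompact α G τ'

/-- `d_α`-extremality: `G / D` is divisible for every dense `α`-pseudocompact subgroup `D`. -/
def DAlphaExtremal (α : Cardinal.{v}) (G : Type u) [AddCommGroup G] [TopologicalSpace G] : Prop :=
  ∀ D : AddSubgroup G, IsDenseAlphaPseudocompact α D → Nonempty (DivisibleBy (G ⧸ D) ℤ)

/-- `c_α`-extremality: the free rank of `G / D` is less than `2 ^ α` for every dense
`α`-pseudocompact subgroup `D`. The free rank is the rank as a `ℤ`-module. -/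
def CAlphaExtremal (α : Cardinal.{v}) (G : Type u) [AddCommGroup G] [TopologicalSpace G] : Prop :=
  ∀ D : AddSubgroup G, IsDenseAlphaPseudocompact α D →
    Cardinal.lift.{v} (Module.rank ℤ (G ⧸ D)) < Cardinal.lift.{u} ((2 : Cardinal.{v}) ^ α)

/-- `α`-extremality: both `d_α`- and `c_α`-extremality. -/
def AlphaExtremal (α : Cardinal.{v}) (G : Type u) [AddCommGroup G] [TopologicalSpace G] : Prop :=
  DAlphaExtremal α G ∧ CAlphaExtremal α G

/-! An `s_α`-extremal group has only the trivial quotient `G ⧸ D`. In the `r_α` case, let `D` be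
dense `α`-pseudocompact. If `G ⧸ D` is not divisible it maps onto some `ZMod p`; if its rank is at
least `2 ^ α ≥ 𝔠` it maps onto the circle. Either way `G` has a homomorphism `h` onto a nontrivial
compact metrizable group `H` that kills `D`. Refining the topology by `h` is strict, since a
continuous `h` vanishing on a dense set would be zero.

The refinement stays `α`-pseudocompact (`IsDenseAlphaPseudocompact.refinement`). Each fibre of `h`
contains a dense translate of `D`, so it is `α`-pseudocompact and dense in `G`. This gives feeble
compactness, hence uniform continuity of real functions, which lets values of `f` be moved into a
single fibre, where the image is compact. -/

open Filter Topology Set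

/-- Every sequence of nonempty open sets accumulates at some point. -/
def FeeblyCompact (X : Type*) [TopologicalSpace X] : Prop :=
  ∀ A : ℕ → Set X, (∀ n, IsOpen (A n)) → (∀ n, (A n).Nonempty) →
    ∃ x, ∀ O ∈ 𝓝 x, ∃ᶠ n in atTop, (O ∩ A n).Nonempty

/-! ### Pseudocompactness and feeble compactness -/

theorem AlphaPseudocompact.of_denseRange {α : Cardinal.{v}} {X Y : Type*} [TopologicalSpace X]
    [TopologicalSpace Y] (hX : AlphaPseudocompact α X) {π : X → Y} (hπ : Continuous π)
    (hd : DenseRange π) : AlphaPseudocompact α Y := by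
  intro f hf
  have hc := hX (f ∘ π) (hf.comp hπ)
  have : range f = range (f ∘ π) := by
    refine Subset.antisymm ?_ (range_comp_subset_range π f)
    rw [← hc.isClosed.closure_eq, range_comp]
    exact hf.range_subset_closure_image_dense hd
  rwa [this]

theorem AlphaPseudocompact.bddAbove_range {α : Cardinal.{v}} (hα : α ≠ 0) {X : Type*}
    [TopologicalSpace X] (hX : AlphaPseudocompact α X) {g : X → ℝ} (hg : Continuous g) :
    BddAbove (range g) := by
  have hne : Nonempty α.out := by
    rw [← Cardinal.mk_ne_zero_iff, Cardinal.mk_out]; exact hα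
  obtain ⟨i⟩ := hne
  have hc := (hX (fun x _ => g x) (continuous_pi fun _ => hg)).image (continuous_apply i)
  rw [← range_comp] at hc
  exact hc.bddAbove

/-- Were no point an accumulation point, bumps of height `n` supported in `A n` would be locally
finite, with a continuous unbounded sum. -/
theorem AlphaPseudocompact.feeblyCompact {α : Cardinal.{v}} (hα : α ≠ 0) {X : Type*}
    [TopologicalSpace X] [CompletelyRegularSpace X] (hX : AlphaPseudocompact α X) :
    FeeblyCompact X := by
  intro A hA hne
  by_contra! hcon
  choose x hx using hne
  have hex : ∀ n, ∃ g : X → ℝ, Continuous g ∧ g (x n) = n ∧ (∀ y, 0 ≤ g y) ∧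
      Function.support g ⊆ A n := by
    intro n
    obtain ⟨f, hf, hf0, hf1⟩ := CompletelyRegularSpace.completely_regular (x n) (A n)ᶜ
      (hA n).isClosed_compl (by simpa using hx n)
    refine ⟨fun y => n * (1 - f y), by fun_prop, by simp [hf0], fun y => ?_, fun y hy => ?_⟩
    · exact mul_nonneg n.cast_nonneg (sub_nonneg.2 (f y).2.2)
    · by_contra hyA
      exact hy (by simp [hf1 hyA])
  choose g hgc hgx hg0 hgs using hex
  have hlf : LocallyFinite fun n => Function.support (g n) := by
    intro y
    obtain ⟨O, hO, hOA⟩ := hcon y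
    refine ⟨O, hO, ?_⟩
    obtain ⟨N, hN⟩ := eventually_atTop.1 hOA
    refine (finite_lt_nat N).subset fun n hn => ?_
    by_contra hnN
    obtain ⟨z, hz1, hz2⟩ := hn
    have : z ∈ O ∩ A n := ⟨hz2, hgs n hz1⟩
    rw [hN n (not_lt.1 hnN)] at this
    exact this
  obtain ⟨C, hC⟩ := hX.bddAbove_range hα (continuous_finsum hgc hlf)
  obtain ⟨n, hn⟩ := exists_nat_gt C
  have h1 : (∑ᶠ i, g i (x n)) ≤ C := hC ⟨x n, rfl⟩
  have h2 : g n (x n) ≤ ∑ᶠ i, g i (x n) :=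
    single_le_finsum n (hlf.point_finite (x n)) fun j => hg0 j _
  rw [hgx] at h2
  linarith

theorem FeeblyCompact.exists_abs_le {X : Type*} [TopologicalSpace X] (hX : FeeblyCompact X)
    {f : X → ℝ} (hf : Continuous f) : ∃ C, ∀ x, |f x| ≤ C := by
  by_contra! hcon
  obtain ⟨z, hz⟩ := hX (fun n : ℕ => {x | (n : ℝ) < |f x|})
    (fun n => isOpen_lt continuous_const hf.abs) (fun n => hcon n)
  have hO : {x | |f x| < |f z| + 1} ∈ 𝓝 z :=
    (isOpen_lt hf.abs continuous_const).mem_nhds (by simp)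
  obtain ⟨N, hN⟩ := exists_nat_gt (|f z| + 1)
  obtain ⟨n, ⟨y, hy1, hy2⟩, hn⟩ := ((hz _ hO).and_eventually (eventually_ge_atTop N)).exists
  have : (N : ℝ) ≤ n := by exact_mod_cast hn
  simp only [mem_ofPred_eq] at hy1 hy2
  linarith

/-- A space is feebly compact if it embeds in `G × H`, with `H` sequentially compact, in such a way
that its fibres over the points of `H` are feebly compact and have dense image in `G`. -/
theorem feeblyCompact_of_fibers {Γ G H : Type*} [TopologicalSpace Γ] [TopologicalSpace G]
    [TopologicalSpace H] [SeqCompactSpace H] {i : Γ → G} {h : Γ → H}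
    (hind : IsInducing fun x => (i x, h x)) (hd : ∀ t, Dense (i '' (h ⁻¹' {t})))
    (hfc : ∀ t, FeeblyCompact (h ⁻¹' {t})) : FeeblyCompact Γ := by
  have hi : Continuous i := continuous_fst.comp hind.continuous
  have hbasis : ∀ x, ∀ O ∈ 𝓝 x, ∃ V W, IsOpen V ∧ i x ∈ V ∧ IsOpen W ∧ h x ∈ W ∧
      ∀ y, i y ∈ V → h y ∈ W → y ∈ O := by
    intro x O hO
    rw [hind.nhds_eq_comap, mem_comap] at hO
    obtain ⟨S, hS, hSO⟩ := hO
    obtain ⟨V, W, hV, hxV, hW, hxW, hVW⟩ := mem_nhds_prod_iff'.1 hS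
    exact ⟨V, W, hV, hxV, hW, hxW, fun y h1 h2 => hSO (hVW ⟨h1, h2⟩)⟩
  intro A hA hne
  choose x hx using hne
  choose V W hV hxV hW hxW hVW using fun n => hbasis (x n) (A n) ((hA n).mem_nhds (hx n))
  obtain ⟨t, φ, hφ, ht⟩ := SeqCompactSpace.tendsto_subseq fun n => h (x n)
  obtain ⟨z, hz⟩ := hfc t (fun k => {y | i y ∈ V (φ k)})
    (fun k => (hV (φ k)).preimage (hi.comp continuous_subtype_val)) (fun k => by
      obtain ⟨_, hv, y, hy, rfl⟩ := (hd t).inter_open_nonempty _ (hV (φ k)) ⟨_, hxV (φ k)⟩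
      exact ⟨⟨y, hy⟩, hv⟩)
  refine ⟨z, fun O hO => ?_⟩
  obtain ⟨V', W', hV', hzV', hW', hzW', hVW'⟩ := hbasis z O hO
  have hzt : h z = t := z.2
  have h1 : ∀ᶠ k in atTop, h (x (φ k)) ∈ W' := ht (hW'.mem_nhds (hzt ▸ hzW'))
  have h2 := hz {y | i y ∈ V'}
    ((hV'.preimage (hi.comp continuous_subtype_val)).mem_nhds hzV')
  refine hφ.tendsto_atTop.frequently ((h2.and_eventually h1).mono ?_)
  rintro k ⟨⟨y, hy1, hy2⟩, hk⟩
  -- The point `y` controls only the `G`-coordinate; density of another fibre replaces it by `w`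
  -- with the same `H`-coordinate as `x (φ k)`.
  obtain ⟨_, hv, w, hw, rfl⟩ := (hd (h (x (φ k)))).inter_open_nonempty _
    (hV'.inter (hV (φ k))) ⟨_, hy1, hy2⟩
  have hw' : h w = h (x (φ k)) := hw
  exact ⟨w, hVW' w hv.1 (hw' ▸ hk), hVW _ w hv.2 (hw' ▸ hxW _)⟩

/-! ### Feebly compact groups -/

section Group

variable {Γ : Type*} [AddCommGroup Γ] [TopologicalSpace Γ] [IsTopologicalAddGroup Γ]

theorem exists_isOpen_sub_subset {U : Set Γ} (hU : U ∈ 𝓝 (0 : Γ)) :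
    ∃ V : Set Γ, IsOpen V ∧ (0 : Γ) ∈ V ∧ V ⊆ U ∧ ∀ x ∈ V, ∀ y ∈ V, x - y ∈ U := by
  have hc : Tendsto (fun p : Γ × Γ => p.1 - p.2) (𝓝 ((0 : Γ), (0 : Γ))) (𝓝 0) := by
    simpa using (continuous_sub (G := Γ)).tendsto ((0 : Γ), (0 : Γ))
  obtain ⟨A, B, hA, h0A, hB, h0B, hAB⟩ := mem_nhds_prod_iff'.1 (hc hU)
  refine ⟨A ∩ B, hA.inter hB, ⟨h0A, h0B⟩, fun x hx => ?_, fun x hx y hy => ?_⟩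
  · simpa using hAB (show (x, (0 : Γ)) ∈ A ×ˢ B from ⟨hx.1, h0B⟩)
  · exact hAB (show (x, y) ∈ A ×ˢ B from ⟨hx.1, hy.2⟩)

theorem sub_mem_nhds_of_mem_nhds_zero (a : Γ) {O : Set Γ} (hO : O ∈ 𝓝 (0 : Γ)) :
    {x | x - a ∈ O} ∈ 𝓝 a := by
  have : Tendsto (fun x : Γ => x - a) (𝓝 a) (𝓝 0) := by
    simpa using (show Continuous fun x : Γ => x - a by fun_prop).tendsto a
  exact this hO

theorem sub_mem_nhds_of_mem_nhds_zero' (a : Γ) {O : Set Γ} (hO : O ∈ 𝓝 (0 : Γ)) :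
    {x | a - x ∈ O} ∈ 𝓝 a := by
  have : Tendsto (fun x : Γ => a - x) (𝓝 a) (𝓝 0) := by
    simpa using (show Continuous fun x : Γ => a - x by fun_prop).tendsto a
  exact this hO

theorem add_mem_nhds_zero_of_mem_nhds {a : Γ} {O : Set Γ} (hO : O ∈ 𝓝 a) :
    {u | a + u ∈ O} ∈ 𝓝 (0 : Γ) := by
  have : Tendsto (fun x : Γ => a + x) (𝓝 0) (𝓝 a) := by
    simpa using (show Continuous fun x : Γ => a + x by fun_prop).tendsto 0
  exact this hO

/-- In a feebly compact group every sequence of nonempty open sets has a subsequence that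
converges to a point, in the sense that each neighbourhood meets almost all of its members. -/
theorem FeeblyCompact.exists_subseq (hΓ : FeeblyCompact Γ) {A : ℕ → Set Γ}
    (hA : ∀ n, IsOpen (A n)) (hne : ∀ n, (A n).Nonempty) :
    ∃ (a : Γ) (φ : ℕ → ℕ), StrictMono φ ∧
      ∀ O ∈ 𝓝 a, ∀ᶠ k in atTop, (O ∩ A (φ k)).Nonempty := by
  choose a ha using hne
  choose half hopen hzero hsub hdiff using
    fun U : {U : Set Γ // U ∈ 𝓝 (0 : Γ)} => exists_isOpen_sub_subset U.2
  let V : ℕ → Set Γ := fun n => {u | a n + u ∈ A n}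
  have hV : ∀ n, V n ∈ 𝓝 (0 : Γ) := fun n =>
    add_mem_nhds_zero_of_mem_nhds ((hA n).mem_nhds (ha n))
  -- Differences of `S (n + 1)` lie in `S n ∩ V n`. The shift in `U` gives `U n ⊆ V n`, and `M = ⋂ U
  -- n` is a subgroup.
  let S : ℕ → {U : Set Γ // U ∈ 𝓝 (0 : Γ)} := fun n => Nat.rec ⟨univ, univ_mem⟩
    (fun n U => ⟨half ⟨U ∩ V n, inter_mem U.2 (hV n)⟩, (hopen _).mem_nhds (hzero _)⟩) n
  let U : ℕ → Set Γ := fun n => S (n + 1)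
  have hUo : ∀ n, IsOpen (U n) := fun n => hopen _
  have hU0 : ∀ n, (0 : Γ) ∈ U n := fun n => hzero _
  have hUn : ∀ n, U n ∈ 𝓝 (0 : Γ) := fun n => (hUo n).mem_nhds (hU0 n)
  have hUV : ∀ n, U n ⊆ V n := fun n x hx => (hsub _ hx).2
  have hUd : ∀ n, ∀ x ∈ U (n + 1), ∀ y ∈ U (n + 1), x - y ∈ U n :=
    fun n x hx y hy => (hdiff _ x hx y hy).1
  have hanti : Antitone U := antitone_nat_of_succ_le fun n x hx => by
    simpa using hUd n x hx 0 (hU0 (n + 1))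
  let M : Set Γ := ⋂ n, U n
  have hMneg : ∀ m ∈ M, -m ∈ M := fun m hm => mem_iInter.2 fun n => by
    simpa using hUd n 0 (hU0 (n + 1)) m (mem_iInter.1 hm (n + 1))
  -- Modulo `M` the `U j` form a base at `0`: otherwise the sets `U j` minus the closure of `M - P`
  -- accumulate at a point, which must lie in `M`.
  have hclaim : ∀ O ∈ 𝓝 (0 : Γ), ∃ j, ∀ u ∈ U j, ∃ m ∈ M, u - m ∈ O := by
    intro O hO
    obtain ⟨P, hPo, hP0, -, hPd⟩ := exists_isOpen_sub_subset hO
    have hPn := hPo.mem_nhds hP0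
    let Q : Set Γ := {x | ∃ m ∈ M, m - x ∈ P}
    by_contra! hcon
    have hW : ∀ j, (U j \ closure Q).Nonempty := by
      intro j
      obtain ⟨u, hu, hum⟩ := hcon j
      refine ⟨u, hu, fun huQ => ?_⟩
      obtain ⟨x, hx, m, hm, hmx⟩ :=
        mem_closure_iff_nhds.1 huQ _ (sub_mem_nhds_of_mem_nhds_zero' u
          (inter_mem hPn (neg_mem_nhds_zero Γ hPn)))
      refine hum m hm ?_
      have := hPd (u - x) hx.1 (m - x) hmx
      simpa using this
    obtain ⟨z, hz⟩ := hΓ (fun j => U j \ closure Q)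
      (fun j => (hUo j).sdiff isClosed_closure) hW
    have hzM : z ∈ M := mem_iInter.2 fun j => by
      obtain ⟨n, ⟨x, hx1, hx2⟩, hn⟩ :=
        ((hz _ (sub_mem_nhds_of_mem_nhds_zero z (hUn (j + 1)))).and_eventually
          (eventually_ge_atTop (j + 1))).exists
      have := hUd j x (hanti hn hx2.1) (x - z) hx1
      simpa using this
    obtain ⟨n, x, hx1, hx2⟩ := (hz _ (sub_mem_nhds_of_mem_nhds_zero' z hPn)).exists
    exact hx2.2 (subset_closure ⟨z, hzM, hx1⟩)
  obtain ⟨b, hb⟩ := hΓ (fun n => {x | x - a n ∈ U n})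
    (fun n => (hUo n).preimage (continuous_id.sub continuous_const))
    (fun n => ⟨a n, by simpa using hU0 n⟩)
  have hfreq : ∀ j, ∃ᶠ n in atTop, a n - b ∈ U j := by
    intro j
    refine ((hb _ (sub_mem_nhds_of_mem_nhds_zero b (hUn (j + 1)))).and_eventually
      (eventually_ge_atTop (j + 1))).mono ?_
    rintro n ⟨⟨x, hx1, hx2⟩, hn⟩
    simpa using hUd j (x - b) hx1 (x - a n) (hanti hn hx2)
  obtain ⟨φ, hφ, hφU⟩ := extraction_forall_of_frequently hfreq
  refine ⟨b, φ, hφ, fun O hO => ?_⟩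
  obtain ⟨j, hj⟩ := hclaim _ (add_mem_nhds_zero_of_mem_nhds hO)
  filter_upwards [eventually_ge_atTop j] with k hk
  -- Subtracting `m` brings `a (φ k)` near `b` without leaving `A (φ k)`, because `-m ∈ M ⊆ V (φ
  -- k)`.
  obtain ⟨m, hm, hmO⟩ := hj _ (hanti hk (hφU k))
  refine ⟨a (φ k) + -m, ?_, hUV _ (mem_iInter.1 (hMneg m hm) _)⟩
  have : b + (a (φ k) - b - m) ∈ O := hmO
  convert this using 1
  abel

/-- Continuous real functions on a feebly compact group are uniformly continuous. -/
theorem FeeblyCompact.uniformly_continuous (hΓ : FeeblyCompact Γ) {f : Γ → ℝ}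
    (hf : Continuous f) {ε : ℝ} (hε : 0 < ε) :
    ∃ U ∈ 𝓝 (0 : Γ), ∀ x, ∀ u ∈ U, |f (x + u) - f x| < ε := by
  by_contra! hcon
  let F : Γ × Γ → ℝ := fun p => |f (p.1 + p.2) - f p.1|
  have hF : Continuous F := by fun_prop
  have hstep : ∀ E : {E : Set Γ // E ∈ 𝓝 (0 : Γ)}, ∃ (A B : Set Γ)
      (E' : {E : Set Γ // E ∈ 𝓝 (0 : Γ)}), IsOpen A ∧ A.Nonempty ∧ IsOpen B ∧ B.Nonempty ∧
      B ⊆ E.1 ∧ E'.1 ⊆ E.1 ∧ (∀ x ∈ A, ∀ u ∈ B, ε / 2 < F (x, u)) ∧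
      ∀ x ∈ A, ∀ u ∈ E'.1, F (x, u) < ε / 4 := by
    rintro ⟨E, hE⟩
    obtain ⟨x, u, hu, hxu⟩ := hcon (interior E) (interior_mem_nhds.2 hE)
    have h1 : {p | ε / 2 < F p} ∈ 𝓝 (x, u) :=
      (isOpen_lt continuous_const hF).mem_nhds (show ε / 2 < F (x, u) from by
        have : ε ≤ F (x, u) := hxu
        linarith)
    have h2 : {p | F p < ε / 4} ∈ 𝓝 (x, (0 : Γ)) :=
      (isOpen_lt hF continuous_const).mem_nhds (by simp [F, hε])
    obtain ⟨A₁, B₁, hA₁, hxA₁, hB₁, huB₁, hAB₁⟩ := mem_nhds_prod_iff'.1 h1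
    obtain ⟨A₂, B₂, hA₂, hxA₂, hB₂, huB₂, hAB₂⟩ := mem_nhds_prod_iff'.1 h2
    exact ⟨A₁ ∩ A₂, B₁ ∩ interior E, ⟨B₂ ∩ E, inter_mem (hB₂.mem_nhds huB₂) hE⟩,
      hA₁.inter hA₂, ⟨x, hxA₁, hxA₂⟩, hB₁.inter isOpen_interior, ⟨u, huB₁, hu⟩,
      fun y hy => interior_subset hy.2, fun y hy => hy.2,
      fun y hy w hw => hAB₁ (show (y, w) ∈ A₁ ×ˢ B₁ from ⟨hy.1, hw.1⟩),
      fun y hy w hw => hAB₂ (show (y, w) ∈ A₂ ×ˢ B₂ from ⟨hy.2, hw.1⟩)⟩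
  choose A B E' hAo hAne hBo hBne hBE hEE hAB hAE using hstep
  let E : ℕ → {E : Set Γ // E ∈ 𝓝 (0 : Γ)} :=
    fun n => Nat.rec ⟨univ, univ_mem⟩ (fun _ E => E' E) n
  have hanti : Antitone fun n => (E n).1 := antitone_nat_of_succ_le fun n => hEE (E n)
  -- Convergence of the `A`s, not mere accumulation, is needed so that `A` and `B` approach `a` and
  -- `b` at the same indices.
  obtain ⟨a, φ, hφ, ha⟩ := hΓ.exists_subseq (fun n => hAo (E n)) fun n => hAne (E n)
  obtain ⟨b, hb⟩ := hΓ (fun k => B (E (φ k))) (fun k => hBo _) fun k => hBne _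
  have hnear : {p | |F p - F (a, b)| < ε / 8} ∈ 𝓝 (a, b) :=
    (isOpen_lt (hF.sub continuous_const).abs continuous_const).mem_nhds
      (show |F (a, b) - F (a, b)| < ε / 8 by rw [sub_self, abs_zero]; positivity)
  obtain ⟨P, Q, hP, haP, hQ, hbQ, hPQ⟩ := mem_nhds_prod_iff'.1 hnear
  have hfr := (hb Q (hQ.mem_nhds hbQ)).and_eventually (ha P (hP.mem_nhds haP))
  obtain ⟨k, ⟨u, hu1, hu2⟩, x, hx1, hx2⟩ := hfr.exists
  obtain ⟨l, ⟨⟨w, hw1, hw2⟩, -⟩, hl⟩ := (hfr.and_eventually (eventually_gt_atTop k)).exists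
  -- For `k < l`, `B` at stage `l` lies in the neighbourhood chosen after stage `k`. So `F (x, u) >
  -- ε / 2` and `F (x, w) < ε / 4`, although both are within `ε / 8` of `F (a, b)`.
  have hwE : w ∈ (E' (E (φ k))).1 := hanti (Nat.succ_le_of_lt (hφ hl)) (hBE _ hw2)
  have h1 := hAB _ x hx2 u hu2
  have h2 := hAE _ x hx2 w hwE
  have h3 : |F (x, u) - F (a, b)| < ε / 8 := hPQ (show (x, u) ∈ P ×ˢ Q from ⟨hx1, hu1⟩)
  have h4 : |F (x, w) - F (a, b)| < ε / 8 := hPQ (show (x, w) ∈ P ×ˢ Q from ⟨hx1, hw1⟩)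
  rw [abs_lt] at h3 h4
  linarith

/-- Coordinates are bounded, so only closedness of the range matters. A limit value `y` is reached
along an ultrafilter on which `h` tends to some `t`; small translations carry its points into the
fibre over `t`, and uniform continuity keeps the values near `y`. -/
theorem alphaPseudocompact_of_fibers {α : Cardinal.{v}} {G H : Type*} [AddCommGroup G]
    [TopologicalSpace G] [AddCommGroup H] [TopologicalSpace H]
    [IsTopologicalAddGroup H] [CompactSpace H] (hΓ : FeeblyCompact Γ) {i : Γ →+ G} {h : Γ →+ H}
    (hind : IsInducing fun x => (i x, h x)) (hd : ∀ t, Dense (i '' (h ⁻¹' {t})))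
    (hfc : ∀ t, AlphaPseudocompact α (h ⁻¹' {t})) : AlphaPseudocompact α Γ := by
  intro f hf
  have hfi : ∀ j, Continuous fun x => f x j := fun j => (continuous_apply j).comp hf
  choose C hC using fun j => hΓ.exists_abs_le (hfi j)
  refine (isCompact_univ_pi fun j => isCompact_Icc (a := -C j) (b := C j)).of_isClosed_subset ?_ ?_
  swap
  · rintro _ ⟨x, rfl⟩ j -
    exact abs_le.1 (hC j x)
  have huc : Tendsto (fun p : Γ × Γ => f (p.1 + p.2) - f p.1) (⊤ ×ˢ 𝓝 0) (𝓝 0) := by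
    refine tendsto_pi_nhds.2 fun j => Metric.tendsto_nhds.2 fun ε hε => ?_
    obtain ⟨U, hU, hUε⟩ := hΓ.uniformly_continuous (hfi j) hε
    filter_upwards [prod_mem_prod univ_mem hU] with p hp
    simpa [Real.dist_eq] using hUε p.1 p.2 hp.2
  refine isClosed_of_closure_subset fun y hy => ?_
  have hne : (comap f (𝓝 y)).NeBot := comap_neBot_iff.2 fun O hO => by
    obtain ⟨_, hz, x, rfl⟩ := mem_closure_iff_nhds.1 hy O hO
    exact ⟨x, hz⟩
  let 𝓤 := Ultrafilter.of (comap f (𝓝 y))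
  have hfU : Tendsto f 𝓤 (𝓝 y) := tendsto_iff_comap.2 (Ultrafilter.of_le _)
  obtain ⟨t, -, ht⟩ := isCompact_univ.ultrafilter_le_nhds (𝓤.map h) (by simp)
  have htU : Tendsto h 𝓤 (𝓝 t) := ht
  have hcl : IsClosed (f '' (h ⁻¹' {t})) := by
    have := (hfc t (fun x => f x) (hf.comp continuous_subtype_val)).isClosed
    rwa [show (fun x : h ⁻¹' {t} => f x) = f ∘ Subtype.val from rfl, range_comp,
      Subtype.range_coe] at this
  suffices y ∈ closure (f '' (h ⁻¹' {t})) by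
    rw [hcl.closure_eq] at this
    exact image_subset_range _ _ this
  refine mem_closure_iff_nhds.2 fun O hO => ?_
  have hadd : Tendsto (fun p : (α.out → ℝ) × (α.out → ℝ) => p.1 + p.2) (𝓝 (y, 0)) (𝓝 y) := by
    simpa using (continuous_add (M := α.out → ℝ)).tendsto (y, 0)
  obtain ⟨O₁, hO₁, O₂, hO₂, hO₁₂⟩ := mem_nhds_prod_iff.1 (hadd hO)
  obtain ⟨P, hP, U, hU, hPU⟩ := mem_prod_iff.1 (huc hO₂)
  rw [mem_top] at hP
  subst hP
  rw [hind.nhds_eq_comap, mem_comap] at hU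
  obtain ⟨S, hS, hSU⟩ := hU
  obtain ⟨A, B, hA, h0A, hB, h0B, hAB⟩ := mem_nhds_prod_iff'.1 hS
  have hB' : ∀ᶠ x in (𝓤 : Filter Γ), t - h x ∈ B := by
    have : Tendsto (fun x => t - h x) 𝓤 (𝓝 0) := by simpa using htU.const_sub t
    exact this (hB.mem_nhds (by simpa using h0B))
  obtain ⟨x, hxB, hxO⟩ := (hB'.and (hfU hO₁)).exists
  -- Density of the fibre over `t - h x` supplies a small `u` with `h (x + u) = t`.
  obtain ⟨_, huA, u, hu, rfl⟩ := (hd (t - h x)).inter_open_nonempty A hA ⟨_, h0A⟩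
  have hu' : h u = t - h x := hu
  have huU : u ∈ U := hSU (hAB (show (i u, h u) ∈ A ×ˢ B from ⟨huA, hu' ▸ hxB⟩))
  have hdiff : f (x + u) - f x ∈ O₂ := hPU (show (x, u) ∈ Set.univ ×ˢ U from ⟨mem_univ _, huU⟩)
  refine ⟨f (x + u), ?_, x + u, by simp [hu'], rfl⟩
  have := hO₁₂ (show (f x, f (x + u) - f x) ∈ O₁ ×ˢ O₂ from ⟨hxO, hdiff⟩)
  simpa using this

end Group

/-! ### Refining the topology by a homomorphism -/

section Refinement

variable {α : Cardinal.{v}} {G H : Type*} [AddCommGroup G] [TopologicalSpace G]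
  [IsTopologicalAddGroup G] [T35Space G] {D : AddSubgroup G} [AddCommGroup H] [TopologicalSpace H]
  [IsTopologicalAddGroup H] [CompactSpace H] [SeqCompactSpace H] [T35Space H]

/-- Let `Γ` be the group `G` with the topology refined by a surjective homomorphism `h` onto a
sequentially compact group, where `h` vanishes on a dense `α`-pseudocompact subgroup. Then `Γ`
is an `α`-pseudocompact Tychonoff group. -/
theorem IsDenseAlphaPseudocompact.refinement (hα : α ≠ 0) (hD : IsDenseAlphaPseudocompact α D)
    {Γ : Type*} [AddCommGroup Γ] [TopologicalSpace Γ] (i : Γ ≃+ G) (h : Γ →+ H)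
    (hind : IsInducing fun x => (i x, h x)) (hsurj : Function.Surjective h)
    (hDh : ∀ x, i x ∈ D → h x = 0) :
    IsTopologicalAddGroup Γ ∧ T35Space Γ ∧ AlphaPseudocompact α Γ := by
  have hgrp : IsTopologicalAddGroup Γ :=
    hind.topologicalAddGroup ((i : Γ →+ G).prod h)
  have hcr : T35Space Γ :=
    IsEmbedding.t35Space ⟨hind, fun x y hxy => i.injective (congrArg Prod.fst hxy)⟩
  have hi : Continuous i := continuous_fst.comp hind.continuous
  have htr : ∀ g : G, DenseRange fun d : D => (d : G) + g := fun g =>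
    (Homeomorph.addRight g).surjective.denseRange.comp hD.1.denseRange_val
      (Homeomorph.addRight g).continuous
  have hfib : ∀ x, ∀ d : D, i.symm (d + i x) ∈ h ⁻¹' {h x} := fun x d => by
    simp [hDh (i.symm d) (by simp)]
  have hd : ∀ t, Dense ((i : Γ →+ G) '' (h ⁻¹' {t})) := by
    intro t
    obtain ⟨x, rfl⟩ := hsurj t
    refine (htr (i x)).mono ?_
    rintro _ ⟨d, rfl⟩
    exact ⟨_, hfib x d, by simp⟩
  have hfc : ∀ t, AlphaPseudocompact α (h ⁻¹' {t}) := by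
    intro t
    obtain ⟨x, rfl⟩ := hsurj t
    -- On a fibre `h` is constant, so the refined topology is the one induced from `G`.
    have hindt : IsInducing fun y : h ⁻¹' {h x} => i y := by
      have h1 := hind.comp (IsInducing.subtypeVal (t := h ⁻¹' {h x}))
      have h2 : IsInducing fun g : G => (g, h x) := isInducing_prodMkLeft (h x)
      refine IsInducing.of_comp_iff h2 |>.1 ?_
      have h3 : ((fun g : G => (g, h x)) ∘ fun y : h ⁻¹' {h x} => i y) =
          (fun y => (i y, h y)) ∘ Subtype.val :=
        funext fun y => congrArg (Prod.mk _) y.2.symm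
      rwa [h3]
    refine hD.2.of_denseRange (π := fun d => ⟨_, hfib x d⟩) ?_ fun y => ?_
    · refine hindt.continuous_iff.2 ?_
      simp only [Function.comp_def, AddEquiv.apply_symm_apply]
      fun_prop
    · rw [hindt.closure_eq_preimage_closure_image, mem_preimage, ← range_comp]
      simp only [Function.comp_def, AddEquiv.apply_symm_apply]
      exact htr (i x) _
  have hfb : FeeblyCompact Γ :=
    feeblyCompact_of_fibers hind hd fun t => (hfc t).feeblyCompact hα
  exact ⟨hgrp, hcr, alphaPseudocompact_of_fibers (i := (i : Γ →+ G)) hfb hind hd hfc⟩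

theorem IsDenseAlphaPseudocompact.not_rAlphaExtremal (hα : α ≠ 0)
    (hD : IsDenseAlphaPseudocompact α D) [Nontrivial H] (h : G →+ H)
    (hsurj : Function.Surjective h) (hDh : D ≤ h.ker) : ¬ RAlphaExtremal α G := by
  intro hr
  have key := @IsDenseAlphaPseudocompact.refinement α G H _ _ _ _ D _ _ _ _ _ _ hα hD G _
    (TopologicalSpace.induced (fun x => (x, h x)) inferInstance) (AddEquiv.refl G) h
    (@IsInducing.mk _ _ (_) _ _ rfl) hsurj fun x hx => hDh hx
  refine hr ⟨TopologicalSpace.induced (fun x => (x, h x)) inferInstance,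
    lt_of_le_of_ne ?_ fun heq => ?_, key⟩
  · exact (induced_mono inf_le_left).trans (induced_compose.trans induced_id).le
  have hh : Continuous h := by
    have h1 : Continuous fun x => (x, h x) := continuous_iff_le_induced.2 heq.ge
    exact continuous_snd.comp h1
  have hker : closure (D : Set G) ⊆ h ⁻¹' {0} :=
    closure_minimal (fun d hd => hDh hd) (isClosed_singleton.preimage hh)
  obtain ⟨t, ht⟩ := exists_ne (0 : H)
  obtain ⟨g, rfl⟩ := hsurj t
  exact ht (hker (hD.1 g))

end Refinement

/-! ### Homomorphisms onto `ZMod p` and the circle -/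

theorem exists_surjective_of_ne_zero {K V : Type*} [Field K] [AddCommGroup V] [Module K V] {x : V}
    (hx : x ≠ 0) : ∃ f : V →+ K, Function.Surjective f := by
  obtain ⟨f, hf⟩ : ∃ f : Module.Dual K V, f x ≠ 0 := by
    by_contra! hcon
    exact hx ((Module.forall_dual_apply_eq_zero_iff K x).1 hcon)
  exact ⟨f.toAddMonoidHom, LinearMap.surjective (f := f) fun h0 => hf (by simp [h0])⟩

/-- Some prime `p` has `pX ≠ X`, and `X ⧸ pX` is then a nonzero vector space over `ZMod p`. -/
theorem exists_prime_surjective_zmod {X : Type*} [AddCommGroup X]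
    (hX : ¬ Nonempty (DivisibleBy X ℤ)) :
    ∃ (p : ℕ) (_ : p.Prime) (h : X →+ ZMod p), Function.Surjective h := by
  have hp : ∃ p : ℕ, p.Prime ∧ ¬ Function.Surjective fun x : X => p • x := by
    by_contra! hcon
    have hn : ∀ n : ℕ, n ≠ 0 → Function.Surjective fun x : X => n • x := by
      intro n
      induction n using Nat.recOnMul with
      | zero => simp
      | one => exact fun _ x => ⟨x, by simp⟩
      | prime p hp => exact fun _ => hcon p hp
      | mul a b iha ihb =>
        intro hab x
        obtain ⟨y, rfl⟩ := iha (left_ne_zero_of_mul hab) x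
        obtain ⟨z, rfl⟩ := ihb (right_ne_zero_of_mul hab) y
        exact ⟨z, mul_smul a b z⟩
    refine hX ⟨divisibleByOfSMulRightSurj X ℤ fun {n} hn0 x => ?_⟩
    obtain ⟨y, hy⟩ := hn n.natAbs (Int.natAbs_ne_zero.2 hn0) x
    have hy' : (n.natAbs : ℤ) • y = x := by rw [natCast_zsmul]; exact hy
    obtain h | h := Int.natAbs_eq n
    · exact ⟨y, by rw [h]; exact hy'⟩
    · exact ⟨-y, by rw [h]; simpa only [neg_smul, smul_neg, neg_neg] using hy'⟩
  obtain ⟨p, hp, hns⟩ := hp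
  have := Fact.mk hp
  let R : AddSubgroup X := (nsmulAddMonoidHom (α := X) p).range
  let : Module (ZMod p) (X ⧸ R) := AddCommGroup.zmodModule fun q => by
    obtain ⟨x, rfl⟩ := QuotientAddGroup.mk_surjective q
    exact (QuotientAddGroup.eq_zero_iff _).2 ⟨x, rfl⟩
  obtain ⟨x, hx⟩ : ∃ x : X, x ∉ R := by
    by_contra! hcon
    exact hns fun x => hcon x
  have hx0 : (x : X ⧸ R) ≠ 0 := fun h0 => hx ((QuotientAddGroup.eq_zero_iff x).1 h0)
  obtain ⟨f, hf⟩ := exists_surjective_of_ne_zero (K := ZMod p) hx0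
  exact ⟨p, hp, f.comp (QuotientAddGroup.mk' R), hf.comp QuotientAddGroup.mk_surjective⟩

/-- An independent set of size at least `𝔠` maps onto the circle; divisibility of the circle extends
this map to `X`. -/
theorem exists_surjective_unitAddCircle {X : Type*} [AddCommGroup X]
    (hX : 𝔠 ≤ Module.rank ℤ X) : ∃ h : X →+ UnitAddCircle, Function.Surjective h := by
  obtain ⟨s, hs, hli⟩ := exists_set_linearIndependent ℤ X
  have hcard : Cardinal.lift.{_, 0} #UnitAddCircle ≤ Cardinal.lift.{0, _} #s := by
    have h1 : #UnitAddCircle ≤ 𝔠 := Cardinal.mk_real ▸ Cardinal.mk_quotient_le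
    rw [hs, Cardinal.lift_uzero]
    exact (Cardinal.lift_le.2 h1).trans (by simpa using hX)
  obtain ⟨e⟩ := Cardinal.lift_mk_le'.1 hcard
  let σ : s → UnitAddCircle := Function.invFun e
  have hσ : Function.Surjective σ := Function.invFun_surjective e.injective
  let l : (s →₀ ℤ) →ₗ[ℤ] UnitAddCircle := Finsupp.lift _ ℤ s σ
  obtain ⟨h, hh⟩ := (Module.Baer.of_divisible UnitAddCircle).extension_property
    (Finsupp.linearCombination ℤ (Subtype.val : s → X)) hli l
  refine ⟨h.toAddMonoidHom, fun t => ?_⟩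
  obtain ⟨x, rfl⟩ := hσ t
  refine ⟨x, ?_⟩
  have := LinearMap.congr_fun hh (Finsupp.single x 1)
  simpa [l] using this

theorem nontrivial_unitAddCircle : Nontrivial UnitAddCircle := by
  refine ⟨((1 / 2 : ℝ) : UnitAddCircle), 0, fun h => ?_⟩
  obtain ⟨n, hn⟩ := (AddCircle.coe_eq_zero_iff (1 : ℝ)).1 h
  have h2 : (2 * n : ℝ) = 1 := by simp at hn; linarith
  have h3 : 2 * n = 1 := by exact_mod_cast h2
  omega

/-! ### The extremality theorem -/

theorem mainTheorem7 (α : Cardinal.{v}) (hα : ℵ₀ ≤ α)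
    (G : Type u) [AddCommGroup G] [TopologicalSpace G] [IsTopologicalAddGroup G] [T35Space G]
    (hG : AlphaPseudocompact α G) (h : SAlphaExtremal α G ∨ RAlphaExtremal α G) :
    AlphaExtremal α G := by
  have hα0 : α ≠ 0 := (Cardinal.aleph0_pos.trans_le hα).ne'
  obtain hs | hr := h
  · refine ⟨fun D hD => ?_, fun D hD => ?_⟩ <;> obtain rfl := hs D hD <;>
      have : Subsingleton (G ⧸ (⊤ : AddSubgroup G)) := QuotientAddGroup.subsingleton_quotient_top
    · exact ⟨divisibleByOfSMulRightSurj _ ℤ fun _ x => ⟨x, Subsingleton.elim _ _⟩⟩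
    · rw [rank_subsingleton', Cardinal.lift_zero, pos_iff_ne_zero, Ne, Cardinal.lift_eq_zero]
      exact Cardinal.power_ne_zero _ two_ne_zero
  · refine ⟨fun D hD => ?_, fun D hD => ?_⟩
    · by_contra hdiv
      obtain ⟨p, hp, f, hf⟩ := exists_prime_surjective_zmod hdiv
      have := Fact.mk hp
      let : TopologicalSpace (ZMod p) := ⊥
      have : DiscreteTopology (ZMod p) := ⟨rfl⟩
      exact hD.not_rAlphaExtremal hα0 (f.comp (QuotientAddGroup.mk' D))
        (hf.comp QuotientAddGroup.mk_surjective)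
        (fun d hd => by simp [AddMonoidHom.mem_ker, (QuotientAddGroup.eq_zero_iff d).2 hd]) hr
    · by_contra! hrank
      have hc : 𝔠 ≤ Module.rank ℤ (G ⧸ D) := by
        -- Infinitude of `α` enters here; elsewhere `α ≠ 0` suffices.
        have h1 : (𝔠 : Cardinal.{v}) ≤ 2 ^ α := by
          rw [← Cardinal.two_power_aleph0]
          exact Cardinal.power_le_power_left two_ne_zero hα
        have h2 := (Cardinal.lift_le.{u}.2 h1).trans hrank
        rwa [Cardinal.lift_continuum, ← Cardinal.lift_continuum.{v, u}, Cardinal.lift_le] at h2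
      have : Nontrivial UnitAddCircle := nontrivial_unitAddCircle
      obtain ⟨f, hf⟩ := exists_surjective_unitAddCircle hc
      exact hD.not_rAlphaExtremal hα0 (f.comp (QuotientAddGroup.mk' D))
        (hf.comp QuotientAddGroup.mk_surjective)
        (fun d hd => by simp [AddMonoidHom.mem_ker, (QuotientAddGroup.eq_zero_iff d).2 hd]) hr
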